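/- Let $T\in[1,\infty]$ and let $L=(L_t)_{0\le t\le T}$ (with $0\le t<\infty$ if $T=\infty$) be a Lévy process on a filtered probability space $(\Omega,\mathcal F,(\mathcal F_t),P)$, i.e. a càdlàg, adapted, real-valued process with $L_0=0$ a.s. such that $L_t-L_s$ is independent of $\mathcal F_s$ for $s<t$, the law of $L_{t+s}-L_t$ does not depend on $t$, and $\lim_{s\to t}P(|L_t-L_s|>\varepsilon)=0$ for all $t$ and all $\varepsilon>0$. Then: 1. The law of $L_1$ is infinitely divisible, i.e. for every $n\ge1$ it is the $n$-fold convolution of some probability measure on $\mathbb R$. 2. $L_1$ has a characteristic triplet: there are $b\in\mathbb R$, $c\ge0$ and a measure $\nu$ on $\mathbb R$ with $\nu(\{0\})=0$ and $\int_{\mathbb R}(1\wedge x^2)\,\nu(dx)<\infty$ such that $E[e^{iuL_1}]=e^{\psi(u)}$ for all $u\in\mathbb R$, where $$\psi(u)=iub-\frac{u^2c}{2}+\int_{\mathbb R}\bigl(e^{iux}-1-iux1_{\{|x|<1\}}\bigr)\,\nu(dx).$$ 3. For every such triplet $(b,c,\nu)$ of $L_1$, with $\psi$ its exponent, for all $t\in[0,T]$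 ($t<\infty$) and all $u\in\mathbb R$, $$E[e^{iuL_t}]=e^{t\psi(u)}=\exp\Bigl[t\Bigl(iub-\frac{u^2c}{2}+\int_{\mathbb R}\bigl(e^{iux}-1-iux1_{\{|x|<1\}}\bigr)\,\nu(dx)\Bigr)\Bigr].$$ -/

import Mathlib

open MeasureTheory ProbabilityTheory Filter Topology
open scoped NNReal ENNReal

noncomputable section

/-- The time set of a process with horizon `T ∈ [0, ∞]`: the interval `[0, T]` if `T` is finite,
and `[0, ∞)` if `T = ∞`. It carries the order and the topology induced by `ℝ≥0`. -/
abbrev TimeInterval (T : ℝ≥0∞) : Type := {t : ℝ≥0 // (t : ℝ≥0∞) ≤ T}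

/-- A real-valued process is càdlàg if each of its paths is right-continuous and has finite left
limits. (At a point that cannot be approached from the left, or from the right, inside the time
set, the corresponding condition is void.) -/
def IsCadlagProcess {Ω : Type*} {T : ℝ≥0∞} (L : TimeInterval T → Ω → ℝ) : Prop :=
  ∀ ω t, Tendsto (fun s ↦ L s ω) (𝓝[>] t) (𝓝 (L t ω)) ∧
    ∃ l : ℝ, Tendsto (fun s ↦ L s ω) (𝓝[<] t) (𝓝 l)

/-- Lévy processes on a filtered probability space `(Ω, m, ℱ, P)`. -/
structure IsLevyProcess {Ω : Type*} {m : MeasurableSpace Ω} {T : ℝ≥0∞}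
    (L : TimeInterval T → Ω → ℝ) (ℱ : Filtration (TimeInterval T) m) (P : Measure Ω) : Prop where
  /-- càdlàg paths -/
  cadlag : IsCadlagProcess L
  /-- `L t` is `ℱ t`-measurable -/
  adapted : Adapted ℱ L
  /-- `L` starts at zero almost surely -/
  zero : ∀ᵐ ω ∂P, L ⟨0, zero_le⟩ ω = 0
  /-- independent increments: `L t - L s` is independent of `ℱ s` -/
  indep : ∀ s t, s < t →
    Indep (MeasurableSpace.comap (fun ω ↦ L t ω - L s ω) inferInstance) (ℱ s) P
  /-- stationary increments: increments over time intervals of equal length have equal laws -/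
  stationary : ∀ s t s' t' : TimeInterval T, s ≤ t → s' ≤ t' →
    (t.1 : ℝ) - s.1 = (t'.1 : ℝ) - s'.1 →
    P.map (fun ω ↦ L t ω - L s ω) = P.map (fun ω ↦ L t' ω - L s' ω)
  /-- stochastic continuity -/
  stochContinuous : ∀ t, ∀ ε : ℝ, 0 < ε →
    Tendsto (fun s ↦ P {ω | ε < |L t ω - L s ω|}) (𝓝 t) (𝓝 0)

/-- The `n`-fold convolution `ρ * ⋯ * ρ`. -/
def convPow (ρ : Measure ℝ) : ℕ → Measure ℝ
  | 0 => Measure.dirac 0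
  | n + 1 => (convPow ρ n).conv ρ

/-- A law `μ` on `ℝ` is infinitely divisible if for every `n ≥ 1` it is the `n`-fold convolution
of some law on `ℝ`. (The case `n = 1` forces `μ` itself to be a probability measure.) -/
def IsInfinitelyDivisible (μ : Measure ℝ) : Prop :=
  ∀ n : ℕ, 1 ≤ n → ∃ ρ : Measure ℝ, IsProbabilityMeasure ρ ∧ μ = convPow ρ n

/-- A Lévy triplet `(b, c, ν)`. -/
structure LevyTriplet where
  /-- drift term -/
  b : ℝ
  /-- Gaussian coefficient -/
  c : ℝ≥0
  /-- Lévy measure -/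
  ν : Measure ℝ
  ν_zero : ν {0} = 0
  lintegral_lt_top : ∫⁻ x, min 1 (ENNReal.ofReal (x ^ 2)) ∂ν < ∞

/-- The integrand `e^{iux} - 1 - iux 1_{|x| < 1}` of the Lévy–Khintchine formula. -/
def levyIntegrand (u x : ℝ) : ℂ :=
  Complex.exp (Complex.I * u * x) - 1 -
    Complex.I * u * x * Set.indicator {y : ℝ | |y| < 1} (fun _ ↦ (1 : ℂ)) x

/-- The exponent
`ψ(u) = i u b - u² c / 2 + ∫ (e^{iux} - 1 - iux 1_{|x| < 1}) ν(dx)` of a Lévy triplet.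
The integrand is bounded by a constant multiple of `min 1 (x ^ 2)`, so the integral converges. -/
def LevyTriplet.exponent (τ : LevyTriplet) (u : ℝ) : ℂ :=
  Complex.I * u * τ.b - (u : ℂ) ^ 2 * ((τ.c : ℝ) : ℂ) / 2 + ∫ x, levyIntegrand u x ∂τ.ν

/-- `τ` is a characteristic triplet of the law `μ`, and hence `τ.exponent` is its characteristic
exponent: the characteristic function of `μ` is `u ↦ exp (ψ(u))`. -/
def LevyTriplet.IsTripletOf (τ : LevyTriplet) (μ : Measure ℝ) : Prop :=
  ∀ u : ℝ, ∫ x, Complex.exp (Complex.I * u * x) ∂μ = Complex.exp (τ.exponent u)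

end

/-! Write φ_t for the characteristic function of L_t. Independent stationary increments give φ_{s+r}
= φ_s φ_r (`charFun_add`), so φ_1 is the n-th power of φ_{1/n}: this is infinite divisibility.
Stochastic continuity makes t ↦ φ_t(u) continuous, so φ_{1/n}(u) → 1 and φ_1 has no zeros. Hence φ_1
= exp ψ with ψ continuous and ψ(0) = 0, and connectedness of the line forces φ_{1/n} = exp(ψ/n).

For the triplet, n(φ_{1/n} - 1) → ψ. With μ_n the law of L_{1/n}, the left side is a drift term plus
the integral of a bounded continuous kernel against G_n = n x²/(1+x²) μ_n(dx). The G_n are tight and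
of bounded mass, so they converge weakly along an ultrafilter; the drifts then converge too, and the
limit measure encodes c and ν (`exists_levyTriplet_exponent_eq_of_charFun`).

The exponent of any triplet is continuous and vanishes at 0, so for a triplet of L_1 it is such a ψ.
Then φ_t = exp(tψ) for t a multiple of 1/n, and for all t by continuity (`charFun_eq_exp`). -/

/-! ### Bounds on the integrand and continuity of the exponent. -/

lemma norm_exp_I_mul_sub_one_sub_le (y : ℝ) :
    ‖Complex.exp (Complex.I * y) - 1 - Complex.I * y‖ ≤ 3 * y ^ 2 := by
  have hn : ‖Complex.I * (y : ℂ)‖ = |y| := by simp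
  rcases le_or_gt |y| 1 with h | h
  · have := Complex.norm_exp_sub_one_sub_id_le (x := Complex.I * y) (by rw [hn]; exact h)
    rw [hn, sq_abs] at this
    nlinarith [sq_nonneg y]
  · have h1 : ‖Complex.exp (Complex.I * y) - 1‖ ≤ |y| := Real.norm_exp_I_mul_ofReal_sub_one_le
    have h2 := norm_sub_le (Complex.exp (Complex.I * y) - 1) (Complex.I * y)
    rw [hn] at h2
    nlinarith [sq_abs y]

lemma norm_exp_I_mul_sub_one_le_two (y : ℝ) : ‖Complex.exp (Complex.I * y) - 1‖ ≤ 2 := by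
  have h := norm_sub_le (Complex.exp (Complex.I * y)) 1
  rw [mul_comm, Complex.norm_exp_ofReal_mul_I, norm_one] at h
  rw [mul_comm]; linarith

lemma norm_levyIntegrand_le (u x : ℝ) :
    ‖levyIntegrand u x‖ ≤ (2 + 3 * u ^ 2) * min 1 (x ^ 2) := by
  unfold levyIntegrand
  have e : Complex.I * (u : ℂ) * x = Complex.I * ((u * x : ℝ) : ℂ) := by push_cast; ring
  rw [e]
  rcases lt_or_ge |x| 1 with h | h
  · rw [Set.indicator_of_mem (by exact h), mul_one]
    have hx : x ^ 2 ≤ 1 := by rw [← sq_abs]; nlinarith [abs_nonneg x]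
    rw [min_eq_right hx]
    have := norm_exp_I_mul_sub_one_sub_le (u * x)
    nlinarith [sq_nonneg x, sq_nonneg (u * x)]
  · rw [Set.indicator_of_notMem (by simpa using h), mul_zero, sub_zero]
    have hx : 1 ≤ x ^ 2 := by rw [← sq_abs]; nlinarith [abs_nonneg x]
    rw [min_eq_left hx]
    have := norm_exp_I_mul_sub_one_le_two (u * x)
    nlinarith [sq_nonneg u]

lemma measurable_levyIntegrand (u : ℝ) : Measurable (levyIntegrand u) := by
  unfold levyIntegrand
  refine Measurable.sub (by fun_prop) (Measurable.mul (by fun_prop) ?_)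
  exact measurable_const.indicator (measurableSet_lt (by fun_prop) (by fun_prop))

lemma LevyTriplet.integrable_min_one_sq (τ : LevyTriplet) :
    Integrable (fun x : ℝ ↦ min 1 (x ^ 2)) τ.ν := by
  refine ⟨by fun_prop, ?_⟩
  rw [hasFiniteIntegral_iff_ofReal (ae_of_all _ fun x ↦ by positivity)]
  simpa [ENNReal.ofReal_min] using τ.lintegral_lt_top

lemma continuous_levyIntegrand_left (x : ℝ) : Continuous fun u ↦ levyIntegrand u x := by
  unfold levyIntegrand; fun_prop

/-- Dominated convergence, with a bound uniform for u near u₀. Continuity identifies the exponent of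
an arbitrary triplet as the right branch of the logarithm. -/
lemma LevyTriplet.continuous_exponent (τ : LevyTriplet) : Continuous τ.exponent := by
  unfold LevyTriplet.exponent
  refine Continuous.add (by fun_prop) (continuous_iff_continuousAt.2 fun u₀ ↦ ?_)
  refine continuousAt_of_dominated
    (bound := fun x ↦ (2 + 3 * (|u₀| + 1) ^ 2) * min 1 (x ^ 2))
    (.of_forall fun u ↦ (measurable_levyIntegrand u).aestronglyMeasurable) ?_
    (τ.integrable_min_one_sq.const_mul _)
    (ae_of_all _ fun x ↦ (continuous_levyIntegrand_left x).continuousAt)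
  filter_upwards [Metric.ball_mem_nhds u₀ one_pos] with u hu
  refine ae_of_all _ fun x ↦ (norm_levyIntegrand_le u x).trans ?_
  have : |u| ≤ |u₀| + 1 := by
    have h1 : |u - u₀| < 1 := by simpa [Real.dist_eq] using hu
    have := abs_sub_abs_le_abs_sub u u₀
    linarith
  have : u ^ 2 ≤ (|u₀| + 1) ^ 2 := by rw [← sq_abs]; gcongr
  gcongr

lemma LevyTriplet.exponent_zero (τ : LevyTriplet) : τ.exponent 0 = 0 := by
  simp [LevyTriplet.exponent, levyIntegrand]

/-! ### Continuous logarithms and roots. -/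

/-- A continuous nowhere vanishing function on the line with value `1` at `0` has a continuous
logarithm vanishing at `0`. -/
lemma exists_continuous_log {f : ℝ → ℂ} (hf : Continuous f) (h0 : ∀ u, f u ≠ 0) (h1 : f 0 = 1) :
    ∃ ψ : ℝ → ℂ, Continuous ψ ∧ ψ 0 = 0 ∧ ∀ u, Complex.exp (ψ u) = f u := by
  let g : C(ℝ, {z : ℂ // z ≠ 0}) := ⟨fun u ↦ ⟨f u, h0 u⟩, by fun_prop⟩
  obtain ⟨F, ⟨hF0, hF⟩, -⟩ := Complex.isCoveringMap_exp.existsUnique_continuousMap_lifts g 0 0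
    (by simp [g, h1])
  exact ⟨F, F.continuous, hF0, fun u ↦ congrArg Subtype.val (congrFun hF u)⟩

/-- A continuous `n`-th root of `exp ψ` with value `1` at `0` is `exp (ψ / n)`. -/
lemma eq_exp_div_of_pow_eq_exp {f ψ : ℝ → ℂ} (hf : Continuous f) (hψ : Continuous ψ)
    (hf0 : f 0 = 1) (hψ0 : ψ 0 = 0) {n : ℕ} (hn : n ≠ 0)
    (h : ∀ u, f u ^ n = Complex.exp (ψ u)) (u : ℝ) : f u = Complex.exp (ψ u / n) := by
  have hfin : {z : ℂ | z ^ n = 1}.Finite := by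
    have : NeZero n := ⟨hn⟩
    refine (Polynomial.nthRootsFinset n (1 : ℂ)).finite_toSet.subset fun z hz ↦ ?_
    simpa [Polynomial.mem_nthRootsFinset (Nat.pos_of_ne_zero hn)] using hz
  have hn' : (n : ℂ) ≠ 0 := by exact_mod_cast hn
  -- The quotient `r` is continuous with values in the finite, hence discrete, set of n-th roots of
  -- unity, so it is constant on the line.
  let r : ℝ → ℂ := fun u ↦ f u * Complex.exp (-(ψ u / n))
  have hr : Continuous r := by fun_prop
  have hmaps : Set.MapsTo r Set.univ {z : ℂ | z ^ n = 1} := fun v _ ↦ by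
    simp only [r, Set.mem_ofPred_eq, mul_pow, h, ← Complex.exp_nat_mul, ← Complex.exp_add]
    rw [show ψ v + n * -(ψ v / n) = 0 by field_simp; ring, Complex.exp_zero]
  have hsub : r u = r 0 :=
    isPreconnected_univ.constant_of_mapsTo hfin.isDiscrete hr.continuousOn hmaps
      (Set.mem_univ _) (Set.mem_univ _)
  simp only [r, hf0, hψ0] at hsub
  rw [Complex.exp_neg, ← div_eq_mul_inv, div_eq_iff (Complex.exp_ne_zero _)] at hsub
  simpa using hsub

/-! ### Triplets encoded by finite measures. -/

noncomputable section

/-- The continuous extension of `x ↦ (e^{iux} - 1 - iux) / x²` to the real line. -/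
def levyKernel (u x : ℝ) : ℂ :=
  if x = 0 then -(u : ℂ) ^ 2 / 2
  else (Complex.exp (Complex.I * u * x) - 1 - Complex.I * u * x) / (x : ℂ) ^ 2

lemma norm_levyKernel_le (u x : ℝ) : ‖levyKernel u x‖ ≤ 3 * u ^ 2 := by
  unfold levyKernel
  split_ifs with h
  · simp; nlinarith [sq_nonneg u]
  · rw [norm_div, norm_pow, Complex.norm_real, Real.norm_eq_abs, sq_abs,
      div_le_iff₀ (by positivity)]
    have := norm_exp_I_mul_sub_one_sub_le (u * x)
    push_cast at this
    rw [← mul_assoc] at this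
    linarith

/-- The difference is the third-order Taylor remainder of exp divided by x²; this gives continuity
at 0, needed to test weak convergence. -/
lemma norm_levyKernel_sub_le (u x : ℝ) :
    ‖levyKernel u x - levyKernel u 0‖ ≤ |u| ^ 3 * |x| * Real.exp (|u| * |x|) := by
  rcases eq_or_ne x 0 with rfl | h
  · simp
  have hx : (x : ℂ) ≠ 0 := by exact_mod_cast h
  have e : levyKernel u x - levyKernel u 0 =
      (Complex.exp (Complex.I * u * x) - ∑ m ∈ Finset.range 3,
        (Complex.I * u * x) ^ m / m.factorial) / (x : ℂ) ^ 2 := by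
    simp only [levyKernel, h, if_false, if_true, Finset.sum_range_succ, Finset.sum_range_zero]
    field_simp
    simp [Nat.factorial]
    ring_nf
  have := Complex.norm_exp_sub_sum_le_norm_mul_exp (Complex.I * u * x) 3
  rw [e, norm_div, norm_pow, Complex.norm_real, Real.norm_eq_abs, div_le_iff₀ (by positivity)]
  refine this.trans (le_of_eq ?_)
  simp only [norm_mul, Complex.norm_I, Complex.norm_real, Real.norm_eq_abs]
  ring_nf

lemma continuous_levyKernel (u : ℝ) : Continuous (levyKernel u) := by
  rw [continuous_iff_continuousAt]
  intro x
  rcases eq_or_ne x 0 with rfl | h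
  · rw [ContinuousAt, tendsto_iff_norm_sub_tendsto_zero]
    refine squeeze_zero (fun _ ↦ norm_nonneg _) (norm_levyKernel_sub_le u) ?_
    have : Continuous fun x : ℝ ↦ |u| ^ 3 * |x| * Real.exp (|u| * |x|) := by fun_prop
    simpa using this.tendsto 0
  · have : (fun x : ℝ ↦ (Complex.exp (Complex.I * u * x) - 1 - Complex.I * u * x) / (x : ℂ) ^ 2)
        =ᶠ[𝓝 x] levyKernel u := by
      filter_upwards [isOpen_ne.mem_nhds h] with y hy
      rw [levyKernel, if_neg hy]
    refine ContinuousAt.congr ?_ this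
    exact ContinuousAt.div (by fun_prop) (by fun_prop) (by simpa using h)

/-- The Lévy–Khintchine integrand for the truncation function `x / (1 + x²)`, relative to the
finite measure `x² / (1 + x²) ν(dx)`. -/
def levyKhintchineKernel (u : ℝ) : BoundedContinuousFunction ℝ ℂ :=
  BoundedContinuousFunction.ofNormedAddCommGroup
    (fun x : ℝ ↦ levyKernel u x + (Complex.exp (Complex.I * u * x) - 1))
    ((continuous_levyKernel u).add (by fun_prop)) (3 * u ^ 2 + 2) fun x ↦ by
      refine (norm_add_le _ _).trans (add_le_add (norm_levyKernel_le u x) ?_)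
      simpa [mul_assoc] using norm_exp_I_mul_sub_one_le_two (u * x)

lemma levyKhintchineKernel_apply (u x : ℝ) : levyKhintchineKernel u x =
    levyKernel u x + (Complex.exp (Complex.I * u * x) - 1) := rfl

/-- The difference of the truncation functions `x 1_{|x| < 1}` and `x / (1 + x²)`, multiplied by
`(1 + x²) / x²`. -/
def truncationShift (x : ℝ) : ℝ := if |x| < 1 then x else -x⁻¹

lemma measurable_truncationShift : Measurable truncationShift :=
  Measurable.ite (measurableSet_lt (by fun_prop) (by fun_prop)) measurable_id measurable_inv.neg

lemma abs_truncationShift_le (x : ℝ) : |truncationShift x| ≤ 1 := by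
  unfold truncationShift
  split_ifs with h
  · exact h.le
  · rw [abs_neg, abs_inv]
    exact inv_le_one_of_one_le₀ (not_lt.1 h)

/-- At x = 0 the weight is 1/0 = 0, so the indicator supplies the value -u²/2; it produces the
Gaussian term. -/
lemma levyKhintchineKernel_eq (u x : ℝ) : levyKhintchineKernel u x =
    ((1 + x ^ 2) / x ^ 2) • levyIntegrand u x + Complex.I * u * (truncationShift x : ℝ) -
      Set.indicator {0} (fun _ ↦ (u : ℂ) ^ 2 / 2) x := by
  rw [levyKhintchineKernel_apply, levyKernel, truncationShift, levyIntegrand]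
  rcases eq_or_ne x 0 with rfl | h
  · simp [neg_div]
  have hx : (x : ℂ) ≠ 0 := by exact_mod_cast h
  rw [if_neg h, Set.indicator_of_notMem (s := {0}) (by simpa using h), Complex.real_smul]
  by_cases h1 : |x| < 1
  · rw [if_pos h1, Set.indicator_of_mem (by exact h1)]
    push_cast
    field_simp
    ring
  · rw [if_neg h1, Set.indicator_of_notMem (by exact h1)]
    push_cast
    field_simp
    ring

lemma norm_weight_smul_levyIntegrand_le (u x : ℝ) :
    ‖((1 + x ^ 2) / x ^ 2) • levyIntegrand u x‖ ≤ (2 + 3 * u ^ 2) * 2 := by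
  rw [norm_smul, Real.norm_of_nonneg (by positivity)]
  calc _ ≤ (1 + x ^ 2) / x ^ 2 * ((2 + 3 * u ^ 2) * min 1 (x ^ 2)) := by
        gcongr; exact norm_levyIntegrand_le u x
    _ = (2 + 3 * u ^ 2) * ((1 + x ^ 2) / x ^ 2 * min 1 (x ^ 2)) := by ring
    _ ≤ _ := by
        gcongr
        rcases eq_or_ne x 0 with rfl | h
        · simp
        rw [div_mul_eq_mul_div, div_le_iff₀ (by positivity)]
        rcases le_total 1 (x ^ 2) with h1 | h1
        · rw [min_eq_left h1]; linarith
        · rw [min_eq_right h1]; nlinarith [sq_nonneg x]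

/-- Every finite measure is `x² / (1 + x²) ν(dx) + c δ₀` for a Lévy triplet, and determines its
exponent up to the drift. -/
lemma exists_levyTriplet_exponent_eq (G : Measure ℝ) [IsFiniteMeasure G] (b : ℝ) :
    ∃ τ : LevyTriplet, ∀ u : ℝ,
      τ.exponent u = Complex.I * u * b + ∫ x, levyKhintchineKernel u x ∂G := by
  let w : ℝ → ℝ := fun x ↦ (1 + x ^ 2) / x ^ 2
  have hw : Measurable w := by fun_prop
  have hw0 : ∀ x, 0 ≤ w x := fun x ↦ by positivity
  let τ : LevyTriplet :=
    -- The drift absorbs the change of truncation function. The atom of `G` at 0 becomes `c`, and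
    -- `ν` loses it because `w 0 = 0`.
    { b := b + ∫ x, truncationShift x ∂G
      c := (G {0}).toNNReal
      ν := G.withDensity fun x ↦ ENNReal.ofReal (w x)
      ν_zero := by
        rw [withDensity_apply _ (measurableSet_singleton 0)]
        simp [w]
      lintegral_lt_top := by
        rw [lintegral_withDensity_eq_lintegral_mul _ (by fun_prop) (by fun_prop)]
        refine lt_of_le_of_lt (lintegral_mono (g := fun _ ↦ 2) fun x ↦ ?_)
          (by simpa using ENNReal.mul_lt_top (by simp) (measure_lt_top G _))
        rw [Pi.mul_apply, ← ENNReal.ofReal_one, ← ENNReal.ofReal_min,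
          ← ENNReal.ofReal_mul (hw0 x)]
        refine (ENNReal.ofReal_le_ofReal (q := 2) ?_).trans (by simp)
        rcases eq_or_ne x 0 with rfl | h
        · simp
        simp only [w]
        rw [div_mul_eq_mul_div, div_le_iff₀ (by positivity)]
        rcases le_total 1 (x ^ 2) with h1 | h1
        · rw [min_eq_left h1]; linarith
        · rw [min_eq_right h1]; nlinarith [sq_nonneg x] }
  refine ⟨τ, fun u ↦ ?_⟩
  have i1 : Integrable (fun x ↦ w x • levyIntegrand u x) G :=
    Integrable.of_bound (hw.smul (measurable_levyIntegrand u)).aestronglyMeasurable _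
      (ae_of_all _ (norm_weight_smul_levyIntegrand_le u))
  have i2 : Integrable (fun x ↦ Complex.I * u * (truncationShift x : ℝ)) G :=
    (Integrable.of_bound measurable_truncationShift.aestronglyMeasurable 1
      (ae_of_all _ abs_truncationShift_le)).ofReal.const_mul _
  have i12 : Integrable (fun x ↦ w x • levyIntegrand u x +
      Complex.I * u * (truncationShift x : ℝ)) G := i1.add i2
  have i3 : Integrable (Set.indicator {0} (fun _ : ℝ ↦ (u : ℂ) ^ 2 / 2)) G :=
    (integrable_const _).indicator (measurableSet_singleton 0)
  have e : ∫ x, levyIntegrand u x ∂τ.ν = ∫ x, w x • levyIntegrand u x ∂G := by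
    rw [integral_withDensity_eq_integral_toReal_smul (by fun_prop) (ae_of_all _ fun _ ↦ by simp)]
    simp only [ENNReal.toReal_ofReal (hw0 _)]
  have e2 : ∫ x, levyKhintchineKernel u x ∂G = ∫ x, (w x • levyIntegrand u x +
      Complex.I * u * (truncationShift x : ℝ)) - Set.indicator {0} (fun _ ↦ (u : ℂ) ^ 2 / 2) x ∂G :=
    integral_congr_ae (ae_of_all _ (levyKhintchineKernel_eq u))
  rw [e2, integral_sub i12 i3, integral_add i1 i2, integral_const_mul, integral_complex_ofReal,
    integral_indicator_const _ (measurableSet_singleton 0), LevyTriplet.exponent, e]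
  simp only [τ, Complex.real_smul, Measure.real, ENNReal.coe_toNNReal_eq_toReal]
  push_cast
  ring

/-! ### Uniform estimates for the weighted laws. -/

lemma norm_mul_exp_div_sub_one_le {a : ℝ} (ha : 1 ≤ a) (z : ℂ) :
    a * ‖1 - Complex.exp (z / a)‖ ≤ ‖z‖ * Real.exp ‖z‖ := by
  have ha0 : 0 < a := by linarith
  have h := Complex.norm_exp_sub_sum_le_norm_mul_exp (z / a) 1
  simp only [Finset.sum_range_one, pow_zero, Nat.factorial_zero, Nat.cast_one, div_one,
    pow_one, norm_div, Complex.norm_real, Real.norm_of_nonneg ha0.le] at h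
  rw [norm_sub_rev]
  calc a * ‖Complex.exp (z / a) - 1‖ ≤ a * (‖z‖ / a * Real.exp (‖z‖ / a)) := by gcongr
    _ = ‖z‖ * Real.exp (‖z‖ / a) := by field_simp
    _ ≤ ‖z‖ * Real.exp ‖z‖ := by
      gcongr
      exact div_le_self (norm_nonneg _) ha

/-- This is the derivative of t ↦ exp(tz) at 0, along t = 1/(n+1). -/
lemma tendsto_mul_exp_div_sub_one (z : ℂ) :
    Tendsto (fun n : ℕ ↦ ((n + 1 : ℝ) : ℂ) * (Complex.exp (z / ((n + 1 : ℝ) : ℂ)) - 1)) atTop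
      (𝓝 z) := by
  have hd : HasDerivAt (fun t : ℝ ↦ Complex.exp (t * z)) z 0 := by
    have h1 : HasDerivAt (fun t : ℝ ↦ (t : ℂ) * z) z 0 := by
      simpa using (Complex.ofRealCLM.hasDerivAt (x := (0 : ℝ))).mul_const z
    simpa using h1.cexp
  have h2 := hd.tendsto_slope_zero_right.comp (f := fun n : ℕ ↦ 1 / ((n : ℝ) + 1)) (x := atTop)
    (tendsto_nhdsWithin_iff.2 ⟨tendsto_one_div_add_atTop_nhds_zero_nat,
      .of_forall fun n ↦ by simp only [Set.mem_Ioi]; positivity⟩)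
  refine h2.congr fun n ↦ ?_
  simp only [Function.comp_apply, Complex.real_smul]
  push_cast
  simp [div_eq_mul_inv, mul_comm]

/-- The measure `a x² / (1 + x²) μ(dx)`. -/
def weightedLaw (a : ℝ) (μ : Measure ℝ) : Measure ℝ :=
  μ.withDensity fun x ↦ ENNReal.ofReal (a * (x ^ 2 / (1 + x ^ 2)))

lemma sq_div_one_add_sq_le_one (x : ℝ) : x ^ 2 / (1 + x ^ 2) ≤ 1 := by
  rw [div_le_one (by positivity)]; linarith

variable {μ : Measure ℝ} [IsProbabilityMeasure μ] {a : ℝ} {ψ : ℝ → ℂ}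

lemma weightedLaw_le (ha : 0 ≤ a) (s : Set ℝ) (hs : MeasurableSet s) :
    weightedLaw a μ s ≤ ENNReal.ofReal (a * μ.real s) := by
  rw [weightedLaw, withDensity_apply _ hs, ENNReal.ofReal_mul ha, measureReal_def,
    ENNReal.ofReal_toReal (measure_ne_top _ _), ← setLIntegral_const]
  refine lintegral_mono fun x ↦ ENNReal.ofReal_le_ofReal ?_
  exact mul_le_of_le_one_right ha (sq_div_one_add_sq_le_one x)

/-- Tail bound for the law with characteristic function `exp (ψ / a)`, uniform in `a ≥ 1`. -/
lemma mul_measureReal_abs_gt_le (ha : 1 ≤ a)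
    (hμ : ∀ u, charFun μ u = Complex.exp (ψ u / a)) {r C : ℝ} (hr : 0 < r)
    (hC : ∀ u, |u| ≤ 2 * r⁻¹ → ‖ψ u‖ ≤ C) :
    a * μ.real {x | r < |x|} ≤ 2 * (C * Real.exp C) := by
  have ha0 : 0 < a := by linarith
  have hC0 : 0 ≤ C := (norm_nonneg _).trans (hC 0 (by simp; positivity))
  have hr' : 0 < 2 * r⁻¹ := by positivity
  -- The tail is controlled by the integral of 1 - φ over [-2/r, 2/r], where 1 - φ is at most C e^C
  -- / a; the factor `a` cancels.
  have h1 := intervalIntegral.norm_integral_le_of_norm_le_const (a := -2 * r⁻¹) (b := 2 * r⁻¹)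
    (f := fun t ↦ 1 - charFun μ t) (C := C * Real.exp C / a) fun t ht ↦ by
      rw [Set.uIoc_of_le (by linarith)] at ht
      have ht' : |t| ≤ 2 * r⁻¹ := abs_le.2 ⟨by linarith [ht.1], ht.2⟩
      rw [hμ, le_div_iff₀' ha0]
      refine (norm_mul_exp_div_sub_one_le ha _).trans ?_
      have := hC t ht'
      gcongr
  rw [abs_of_nonneg (by linarith)] at h1
  calc a * μ.real {x | r < |x|}
      ≤ a * (2⁻¹ * r * (C * Real.exp C / a * (2 * r⁻¹ - -2 * r⁻¹))) := by
        gcongr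
        refine (measureReal_abs_gt_le_integral_charFun hr).trans ?_
        gcongr
    _ = 2 * (C * Real.exp C) := by field_simp; ring

lemma sq_div_one_add_sq_le (x : ℝ) :
    x ^ 2 / (1 + x ^ 2) ≤
      Set.indicator {x : ℝ | 1 < |x|} (fun _ ↦ 1) x + 5 * (1 - Real.cos x) := by
  by_cases h : 1 < |x|
  · rw [Set.indicator_of_mem (by exact h)]
    linarith [Real.cos_le_one x, sq_div_one_add_sq_le_one x]
  · rw [Set.indicator_of_notMem (by exact h), zero_add]
    have hpi := Real.pi_gt_three
    have hpi4 := Real.pi_lt_d2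
    have h1 := Real.cos_le_one_sub_mul_cos_sq (x := x) (by linarith)
    -- The constant 5 works because π² < 10.
    have h2 : 1 / 5 ≤ 2 / Real.pi ^ 2 := by
      rw [div_le_div_iff₀ (by norm_num) (by positivity)]; nlinarith
    have h3 : x ^ 2 / (1 + x ^ 2) ≤ x ^ 2 := div_le_self (sq_nonneg x) (by nlinarith [sq_nonneg x])
    nlinarith [sq_nonneg x]

lemma integral_one_sub_cos (μ : Measure ℝ) [IsProbabilityMeasure μ] :
    ∫ x, (1 - Real.cos x) ∂μ = (1 - charFun μ 1).re := by
  have hi : Integrable (fun x : ℝ ↦ Complex.exp (x * Complex.I)) μ :=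
    Integrable.of_bound (by fun_prop) 1 (ae_of_all _ fun x ↦ by simp [Complex.norm_exp_ofReal_mul_I])
  have hc : Integrable Real.cos μ :=
    Integrable.of_bound (by fun_prop) 1 (ae_of_all _ Real.abs_cos_le_one)
  rw [integral_sub (integrable_const _) hc, charFun_apply_real, Complex.sub_re]
  congr 1
  · simp
  · simp only [Complex.ofReal_one, one_mul]
    have := integral_re hi
    simp only [RCLike.re_eq_complex_re, Complex.exp_ofReal_mul_I_re] at this
    exact this

/-- The weight is split into a tail |x| > 1 and 5(1 - cos x), both governed by the characteristic
function; the tail contributes 2 and the cosine 5 to the constant 7. -/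
lemma weightedLaw_univ_le (ha : 1 ≤ a)
    (hμ : ∀ u, charFun μ u = Complex.exp (ψ u / a)) {C : ℝ}
    (hC : ∀ u, |u| ≤ 2 → ‖ψ u‖ ≤ C) :
    weightedLaw a μ Set.univ ≤ ENNReal.ofReal (7 * (C * Real.exp C)) := by
  have ha0 : 0 < a := by linarith
  have hm : MeasurableSet {x : ℝ | 1 < |x|} := measurableSet_lt (by fun_prop) (by fun_prop)
  have i0 : Integrable (fun x : ℝ ↦ x ^ 2 / (1 + x ^ 2)) μ :=
    Integrable.of_bound (Measurable.aestronglyMeasurable (by fun_prop)) 1 (ae_of_all _ fun x ↦ by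
      rw [Real.norm_of_nonneg (by positivity)]; exact sq_div_one_add_sq_le_one x)
  have i1 : Integrable (Set.indicator {x : ℝ | 1 < |x|} (fun _ ↦ (1 : ℝ))) μ :=
    (integrable_const _).indicator hm
  have i2 : Integrable (fun x ↦ 5 * (1 - Real.cos x)) μ :=
    (((integrable_const _).sub
      (Integrable.of_bound (by fun_prop) 1 (ae_of_all _ Real.abs_cos_le_one))).const_mul 5)
  rw [weightedLaw, withDensity_apply _ MeasurableSet.univ, Measure.restrict_univ,
    ← ofReal_integral_eq_lintegral_ofReal (i0.const_mul a) (ae_of_all _ fun x ↦ by positivity),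
    integral_const_mul]
  refine ENNReal.ofReal_le_ofReal ?_
  have h1 : ∫ x, x ^ 2 / (1 + x ^ 2) ∂μ ≤
      μ.real {x | 1 < |x|} + 5 * ‖1 - charFun μ 1‖ := by
    refine (integral_mono i0 (i1.add i2) sq_div_one_add_sq_le).trans ?_
    simp only [Pi.add_apply]
    rw [integral_add i1 i2, integral_indicator_const _ hm, integral_const_mul,
      integral_one_sub_cos]
    have := Complex.re_le_norm (1 - charFun μ 1)
    simp only [smul_eq_mul, mul_one]
    linarith
  have h2 := mul_measureReal_abs_gt_le ha hμ one_pos (C := C) (by simpa using hC)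
  have h3 : a * ‖1 - charFun μ 1‖ ≤ C * Real.exp C := by
    rw [hμ]
    refine (norm_mul_exp_div_sub_one_le ha _).trans ?_
    have := hC 1 (by simp)
    have := (norm_nonneg _).trans this
    gcongr
  nlinarith

/-- Pointwise, e^{iux} - 1 = iux/(1+x²) + x²/(1+x²) · K_u(x), with K_u the kernel
`levyKhintchineKernel u`. -/
lemma mul_charFun_sub_one_eq (ha : 0 ≤ a) (u : ℝ) :
    (a : ℂ) * (charFun μ u - 1) =
      Complex.I * u * (a * ∫ x, x / (1 + x ^ 2) ∂μ : ℝ) +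
        ∫ x, levyKhintchineKernel u x ∂(weightedLaw a μ) := by
  have hw : ∀ x : ℝ, 0 ≤ a * (x ^ 2 / (1 + x ^ 2)) := fun x ↦ by positivity
  have i0 : Integrable (fun x : ℝ ↦ x / (1 + x ^ 2)) μ :=
    Integrable.of_bound (Measurable.aestronglyMeasurable (by fun_prop)) 1 (ae_of_all _ fun x ↦ by
      rw [norm_div, Real.norm_eq_abs, Real.norm_of_nonneg (by positivity),
        div_le_one (by positivity), ← sq_abs]
      nlinarith [sq_nonneg (|x| - 1), abs_nonneg x])
  have i1 : Integrable (fun x : ℝ ↦ Complex.exp (u * x * Complex.I)) μ :=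
    Integrable.of_bound (by fun_prop) 1 (ae_of_all _ fun x ↦ by
      rw [← Complex.ofReal_mul, Complex.norm_exp_ofReal_mul_I])
  have i2 : Integrable (fun x : ℝ ↦ Complex.exp (u * x * Complex.I) - 1) μ :=
    i1.sub (integrable_const _)
  have i3 : Integrable (fun x : ℝ ↦ Complex.I * u * ((x / (1 + x ^ 2) : ℝ) : ℂ)) μ :=
    i0.ofReal.const_mul _
  have e : ∫ x, levyKhintchineKernel u x ∂(weightedLaw a μ) =
      ∫ x : ℝ, (a : ℂ) * ((Complex.exp (u * x * Complex.I) - 1) -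
        Complex.I * u * ((x / (1 + x ^ 2) : ℝ) : ℂ)) ∂μ := by
    rw [weightedLaw, integral_withDensity_eq_integral_toReal_smul (by fun_prop)
      (ae_of_all _ fun _ ↦ by simp)]
    refine integral_congr_ae (ae_of_all _ fun x ↦ ?_)
    simp only [ENNReal.toReal_ofReal (hw _), levyKhintchineKernel_apply, levyKernel,
      Complex.real_smul]
    rcases eq_or_ne x 0 with rfl | h
    · simp
    have hx : (x : ℂ) ≠ 0 := by exact_mod_cast h
    have hx1 : (1 + x ^ 2 : ℂ) ≠ 0 := by
      have : (1 + x ^ 2 : ℝ) ≠ 0 := by positivity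
      exact_mod_cast this
    rw [if_neg h, show (u : ℂ) * x * Complex.I = Complex.I * u * x by ring]
    push_cast
    field_simp
    ring
  rw [e, integral_const_mul, integral_sub i2 i3, integral_sub i1 (integrable_const _),
    integral_const_mul, integral_complex_ofReal, charFun_apply_real]
  simp
  ring

end

/-! ### Compactness and the Lévy–Khintchine representation. -/

/-- A tight sequence of finite measures of bounded mass converges weakly along some ultrafilter. -/
lemma exists_ultrafilter_tendsto_of_tight {G : ℕ → FiniteMeasure ℝ} {C : ℝ≥0}
    (hC : ∀ n, (G n).mass ≤ C)
    (ht : ∀ ε : ℝ≥0, 0 < ε → ∃ r : ℝ, ∀ n, G n {x | r < |x|} ≤ ε) :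
    ∃ (l : Ultrafilter ℕ) (G' : FiniteMeasure ℝ), (l : Filter ℕ) ≤ atTop ∧ Tendsto G l (𝓝 G') := by
  have hpos : ∀ k : ℕ, (0 : ℝ≥0) < 1 / ((k : ℝ≥0) + 1) := fun k ↦ by positivity
  choose r hr using fun k ↦ ht _ (hpos k)
  have hcompact := isCompact_setOfPred_finiteMeasure_mass_le_compl_isCompact_le
    (u := fun k : ℕ ↦ 1 / ((k : ℝ≥0) + 1)) (K := fun k ↦ Metric.closedBall (0 : ℝ) (r k)) C
    tendsto_one_div_add_atTop_nhds_zero_nat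
    (fun k ↦ isCompact_closedBall _ _) (Or.inl inferInstance)
  have hmem : ∀ n, G n ∈ {μ : FiniteMeasure ℝ | μ.mass ≤ C ∧
      ∀ k : ℕ, μ (Metric.closedBall (0 : ℝ) (r k))ᶜ ≤ 1 / ((k : ℝ≥0) + 1)} := fun n ↦ by
    refine ⟨hC n, fun k ↦ ?_⟩
    have : (Metric.closedBall (0 : ℝ) (r k))ᶜ = {x | r k < |x|} := by
      ext x; simp
    rw [this]
    exact hr k n
  obtain ⟨G', -, hG'⟩ := hcompact.ultrafilter_le_nhds ((hyperfilter ℕ).map G)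
    (le_principal_iff.2 (Filter.mem_map.2 (Eventually.of_forall hmem)))
  exact ⟨hyperfilter ℕ, G', Nat.hyperfilter_le_atTop, hG'⟩

/-- **Lévy–Khintchine representation**: a continuous function `ψ` with `ψ 0 = 0` such that each
`exp (ψ / n)` is a characteristic function is the exponent of a Lévy triplet. -/
theorem exists_levyTriplet_exponent_eq_of_charFun {μ : ℕ → Measure ℝ}
    [∀ n, IsProbabilityMeasure (μ n)] {ψ : ℝ → ℂ} (hψ : Continuous ψ) (hψ0 : ψ 0 = 0)
    (hμ : ∀ n u, charFun (μ n) u = Complex.exp (ψ u / ((n + 1 : ℝ) : ℂ))) :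
    ∃ τ : LevyTriplet, ∀ u, τ.exponent u = ψ u := by
  have ha (n : ℕ) : (1 : ℝ) ≤ n + 1 := by simp
  have ha0 (n : ℕ) : (0 : ℝ) ≤ n + 1 := by positivity
  obtain ⟨C, hC⟩ := (isCompact_closedBall (0 : ℝ) 2).exists_bound_of_continuousOn hψ.continuousOn
  have hmass (n : ℕ) : weightedLaw (n + 1) (μ n) Set.univ ≤ ENNReal.ofReal (7 * (C * Real.exp C)) :=
    weightedLaw_univ_le (ha n) (hμ n) fun u hu ↦ hC u (by simpa using hu)
  let G (n : ℕ) : FiniteMeasure ℝ :=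
    ⟨weightedLaw (n + 1) (μ n), ⟨(hmass n).trans_lt ENNReal.ofReal_lt_top⟩⟩
  obtain ⟨l, G', hl, hG⟩ := exists_ultrafilter_tendsto_of_tight (G := G)
    (C := (7 * (C * Real.exp C)).toNNReal)
    (fun n ↦ by
      rw [← ENNReal.coe_le_coe, FiniteMeasure.ennreal_mass]
      exact hmass n)
    (fun ε hε ↦ by
      have hcont : Continuous fun y : ℝ ↦ 2 * (y * Real.exp y) := by fun_prop
      obtain ⟨η, hη, hη'⟩ : ∃ η > 0, 2 * (η * Real.exp η) ≤ (ε : ℝ) := by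
        have h1 : ∀ᶠ y in 𝓝[>] (0 : ℝ), 2 * (y * Real.exp y) ≤ (ε : ℝ) :=
          (hcont.tendsto 0).eventually_le_const (by simpa using hε) |>.filter_mono
            nhdsWithin_le_nhds
        obtain ⟨y, hy, hy'⟩ := (h1.and self_mem_nhdsWithin).exists
        exact ⟨y, hy', hy⟩
      obtain ⟨δ, hδ, hδ'⟩ := Metric.continuousAt_iff.1 (hψ.continuousAt (x := 0)) η hη
      -- With r = 4/δ the frequencies involved satisfy |u| ≤ 2/r = δ/2, where ψ is smaller than `η`.
      refine ⟨4 / δ, fun n ↦ ?_⟩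
      rw [← ENNReal.coe_le_coe, FiniteMeasure.ennreal_coeFn_eq_coeFn_toMeasure]
      refine (weightedLaw_le (ha0 n) _ (measurableSet_lt (by fun_prop) (by fun_prop))).trans ?_
      rw [← ENNReal.ofReal_coe_nnreal]
      refine ENNReal.ofReal_le_ofReal (le_trans ?_ hη')
      refine mul_measureReal_abs_gt_le (ha n) (hμ n) (by positivity) fun u hu ↦ ?_
      have hu' : |u| < δ := by
        refine hu.trans_lt ?_
        field_simp
        norm_num
      have := hδ' (x := u) (by simpa using hu')
      rw [hψ0, dist_zero_right] at this
      exact this.le)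
  rw [FiniteMeasure.tendsto_iff_forall_integral_rclike_tendsto ℂ] at hG
  have hlim (u : ℝ) : Tendsto (fun n : ℕ ↦ Complex.I * u *
      (((n + 1 : ℝ) * ∫ x, x / (1 + x ^ 2) ∂(μ n) : ℝ) : ℂ)) l
      (𝓝 (ψ u - ∫ x, levyKhintchineKernel u x ∂(G' : Measure ℝ))) := by
    refine (((tendsto_mul_exp_div_sub_one (ψ u)).mono_left hl).sub
      (hG (levyKhintchineKernel u))).congr fun n ↦ ?_
    rw [← hμ, mul_charFun_sub_one_eq (ha0 n)]
    exact add_sub_cancel_right _ _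
  -- The drifts are the imaginary parts at u = 1 of a convergent sequence, so they converge.
  set b : ℝ := (ψ 1 - ∫ x, levyKhintchineKernel 1 x ∂(G' : Measure ℝ)).im with hb
  have hb' : Tendsto (fun n : ℕ ↦ (n + 1 : ℝ) * ∫ x, x / (1 + x ^ 2) ∂(μ n)) l (𝓝 b) := by
    refine ((Complex.continuous_im.tendsto _).comp (hlim 1)).congr fun n ↦ ?_
    simp only [Function.comp_apply, Complex.ofReal_one, mul_one, Complex.I_mul_im,
      Complex.ofReal_re]
  obtain ⟨τ, hτ⟩ := exists_levyTriplet_exponent_eq (G' : Measure ℝ) b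
  refine ⟨τ, fun u ↦ ?_⟩
  have h1 := tendsto_nhds_unique (hlim u)
    (((Complex.continuous_ofReal.tendsto b).comp hb').const_mul (Complex.I * u))
  rw [hτ, ← h1]
  ring

/-! ### Characteristic functions of convolution powers and of Lévy processes. -/

lemma charFun_convPow (ρ : Measure ℝ) [IsProbabilityMeasure ρ] (n : ℕ) :
    IsProbabilityMeasure (convPow ρ n) ∧ ∀ u, charFun (convPow ρ n) u = charFun ρ u ^ n := by
  induction n with
  | zero => exact ⟨by unfold convPow; infer_instance, fun u ↦ by simp [convPow, charFun_dirac]⟩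
  | succ n ih =>
    obtain ⟨_, ih⟩ := ih
    refine ⟨by unfold convPow; infer_instance, fun u ↦ ?_⟩
    rw [convPow, charFun_conv, ih, pow_succ]

lemma integral_exp_eq_charFun (μ : Measure ℝ) (u : ℝ) :
    ∫ x, Complex.exp (Complex.I * u * x) ∂μ = charFun μ u := by
  rw [charFun_apply_real]
  congr with x
  ring_nf

namespace IsLevyProcess

variable {Ω : Type*} {m : MeasurableSpace Ω} {P : Measure Ω}
  {T : ℝ≥0∞} {ℱ : Filtration (TimeInterval T) m} {L : TimeInterval T → Ω → ℝ}

lemma measurable (hL : IsLevyProcess L ℱ P) (t : TimeInterval T) : Measurable (L t) :=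
  (hL.adapted t).mono (ℱ.le t) le_rfl

lemma map_sub_eq (hL : IsLevyProcess L ℱ P) {s t r : TimeInterval T} (hst : s ≤ t)
    (hr : s.1 + r.1 = t.1) : P.map (fun ω ↦ L t ω - L s ω) = P.map (L r) := by
  rw [hL.stationary s t ⟨0, zero_le⟩ r hst (zero_le (a := r.1)) (by rw [← hr]; simp)]
  refine Measure.map_congr ?_
  filter_upwards [hL.zero] with ω h
  rw [h, sub_zero]

variable [IsProbabilityMeasure P]

lemma charFun_zero_time (hL : IsLevyProcess L ℱ P) (u : ℝ) :
    charFun (P.map (L ⟨0, zero_le⟩)) u = 1 := by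
  rw [Measure.map_congr (g := fun _ ↦ (0 : ℝ)) hL.zero, Measure.map_const]
  simp [charFun_dirac]

lemma charFun_add (hL : IsLevyProcess L ℱ P) {s t r : TimeInterval T}
    (hr : s.1 + r.1 = t.1) (u : ℝ) :
    charFun (P.map (L t)) u = charFun (P.map (L s)) u * charFun (P.map (L r)) u := by
  have hst : s ≤ t := by
    change s.1 ≤ t.1
    rw [← hr]; exact le_self_add
  -- Independence of increments is available only for s < t, so s = t is treated apart.
  rcases hst.eq_or_lt with rfl | hlt
  · have : r = ⟨0, zero_le⟩ := Subtype.ext (by simpa using hr)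
    rw [this, hL.charFun_zero_time, mul_one]
  have hind : IndepFun (L s) (fun ω ↦ L t ω - L s ω) P := by
    refine (indep_of_indep_of_le_right (hL.indep s t hlt) ?_).symm
    exact (hL.adapted s).comap_le
  have h := IndepFun.charFun_map_add_eq_mul (hL.measurable s).aemeasurable
    ((hL.measurable t).sub (hL.measurable s)).aemeasurable hind
  have e : L s + (L t - L s) = L t := add_sub_cancel _ _
  rw [e] at h
  rw [← hL.map_sub_eq hst hr]
  exact congrFun h u

/-- Stochastic continuity is convergence in measure, which implies convergence in distribution. -/
lemma continuous_charFun_time (hL : IsLevyProcess L ℱ P) (u : ℝ) :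
    Continuous fun t ↦ charFun (P.map (L t)) u := by
  refine continuous_iff_continuousAt.2 fun t ↦ ?_
  have hm : TendstoInMeasure P L (𝓝 t) (L t) := by
    rw [tendstoInMeasure_iff_norm]
    intro ε hε
    refine tendsto_of_tendsto_of_tendsto_of_le_of_le tendsto_const_nhds
      -- Halving `ε` passes from the strict inequality to the non-strict one.
      (hL.stochContinuous t (ε / 2) (by positivity)) (fun _ ↦ zero_le) fun s ↦ ?_
    refine measure_mono fun ω (hω : ε ≤ ‖L s ω - L t ω‖) ↦ ?_
    rw [Real.norm_eq_abs, abs_sub_comm] at hω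
    exact (half_lt_self hε).trans_le hω
  have hd := (hm.tendstoInDistribution fun s ↦ (hL.measurable s).aemeasurable).tendsto
  exact tendsto_of_seq_tendsto fun x hx ↦
    ProbabilityMeasure.tendsto_iff_tendsto_charFun.1 (hd.comp hx) u

lemma charFun_nsmul (hL : IsLevyProcess L ℱ P) {r : TimeInterval T} (k : ℕ) {t : TimeInterval T}
    (ht : t.1 = k * r.1) (u : ℝ) :
    charFun (P.map (L t)) u = charFun (P.map (L r)) u ^ k := by
  induction k generalizing t with
  | zero =>
    have : t = ⟨0, zero_le⟩ := Subtype.ext (by simpa using ht)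
    rw [this, hL.charFun_zero_time, pow_zero]
  | succ k ih =>
    have hle : (k : ℝ≥0) * r.1 ≤ t.1 := by rw [ht]; gcongr; simp
    let s : TimeInterval T := ⟨k * r.1, le_trans (by exact_mod_cast hle) t.2⟩
    rw [hL.charFun_add (s := s) (r := r) (by rw [ht]; push_cast; ring), ih rfl, pow_succ]

/-- The time `1 / (n + 1)`. -/
noncomputable def unitFraction (hT : 1 ≤ T) (n : ℕ) : TimeInterval T :=
  ⟨1 / ((n : ℝ≥0) + 1), by
    refine le_trans ?_ hT
    have : (1 / ((n : ℝ≥0) + 1)) ≤ 1 := by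
      rw [div_le_one (by positivity)]; simp
    exact_mod_cast this⟩

lemma charFun_unitFraction_pow (hL : IsLevyProcess L ℱ P) (hT : 1 ≤ T) (n : ℕ) (u : ℝ) :
    charFun (P.map (L (unitFraction hT n))) u ^ (n + 1) = charFun (P.map (L ⟨1, hT⟩)) u := by
  refine (hL.charFun_nsmul (n + 1) ?_ u).symm
  simp only [unitFraction]
  push_cast
  field_simp

lemma isProbabilityMeasure_map (hL : IsLevyProcess L ℱ P) (t : TimeInterval T) :
    IsProbabilityMeasure (P.map (L t)) :=
  Measure.isProbabilityMeasure_map (hL.measurable t).aemeasurable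

lemma continuous_charFun_map (hL : IsLevyProcess L ℱ P) (t : TimeInterval T) :
    Continuous (charFun (P.map (L t))) :=
  have := hL.isProbabilityMeasure_map t
  continuous_charFun

/-- φ_{1/(n+1)}(u) tends to φ_0(u) = 1, so it is nonzero for some n, and φ_1(u) is a power of it. -/
lemma charFun_one_ne_zero (hL : IsLevyProcess L ℱ P) (hT : 1 ≤ T) (u : ℝ) :
    charFun (P.map (L ⟨1, hT⟩)) u ≠ 0 := by
  have hlim : Tendsto (unitFraction hT) atTop (𝓝 ⟨0, zero_le⟩) :=
    tendsto_subtype_rng.2 tendsto_one_div_add_atTop_nhds_zero_nat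
  have h := ((hL.continuous_charFun_time u).tendsto _).comp hlim
  rw [hL.charFun_zero_time] at h
  obtain ⟨n, hn⟩ := (h.eventually_ne one_ne_zero).exists
  rw [← hL.charFun_unitFraction_pow hT n]
  exact pow_ne_zero _ hn

lemma charFun_unitFraction (hL : IsLevyProcess L ℱ P) (hT : 1 ≤ T) {ψ : ℝ → ℂ}
    (hψ : Continuous ψ) (hψ0 : ψ 0 = 0)
    (h : ∀ u, charFun (P.map (L ⟨1, hT⟩)) u = Complex.exp (ψ u)) (n : ℕ) (u : ℝ) :
    charFun (P.map (L (unitFraction hT n))) u = Complex.exp (ψ u / ((n + 1 : ℝ) : ℂ)) := by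
  have := hL.isProbabilityMeasure_map (unitFraction hT n)
  have e := eq_exp_div_of_pow_eq_exp (hL.continuous_charFun_map _) hψ (by simp) hψ0
    n.succ_ne_zero (fun u ↦ (hL.charFun_unitFraction_pow hT n u).trans (h u)) u
  rw [e]
  push_cast
  rfl

/-- The characteristic function of `L t` is `exp (t ψ)`, for `ψ` the continuous logarithm of the
characteristic function of `L 1`. -/
lemma charFun_eq_exp (hL : IsLevyProcess L ℱ P) (hT : 1 ≤ T) {ψ : ℝ → ℂ}
    (hψ : Continuous ψ) (hψ0 : ψ 0 = 0)
    (h : ∀ u, charFun (P.map (L ⟨1, hT⟩)) u = Complex.exp (ψ u)) (t : TimeInterval T) (u : ℝ) :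
    charFun (P.map (L t)) u = Complex.exp (((t.1 : ℝ) : ℂ) * ψ u) := by
  -- Rounding down keeps the approximating times k/(n+1) below t, hence inside the time set.
  let k (n : ℕ) : ℕ := ⌊(t.1 : ℝ) * ((n : ℝ) + 1)⌋₊
  have hk (n : ℕ) : (k n : ℝ≥0) * (1 / ((n : ℝ≥0) + 1)) ≤ t.1 := by
    rw [mul_one_div, div_le_iff₀ (by positivity), ← NNReal.coe_le_coe]
    push_cast
    exact Nat.floor_le (by positivity)
  let q (n : ℕ) : TimeInterval T :=
    ⟨k n * (1 / ((n : ℝ≥0) + 1)), le_trans (by exact_mod_cast hk n) t.2⟩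
  have hq : Tendsto (fun n ↦ ((q n).1 : ℝ)) atTop (𝓝 (t.1 : ℝ)) := by
    have := (tendsto_nat_floor_mul_div_atTop (R := ℝ) t.1.2).comp
      (tendsto_atTop_add_const_right _ 1 tendsto_natCast_atTop_atTop)
    refine this.congr fun n ↦ ?_
    simp only [q, k, Function.comp_apply]
    push_cast
    rw [mul_one_div]
    rfl
  have h1 := ((hL.continuous_charFun_time u).tendsto t).comp
    (tendsto_subtype_rng.2 (NNReal.tendsto_coe.1 hq))
  have h2 : Tendsto (fun n ↦ Complex.exp ((((q n).1 : ℝ) : ℂ) * ψ u)) atTop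
      (𝓝 (Complex.exp (((t.1 : ℝ) : ℂ) * ψ u))) :=
    (Complex.continuous_exp.tendsto _).comp
      (((Complex.continuous_ofReal.tendsto _).comp hq).mul_const _)
  refine tendsto_nhds_unique h1 (h2.congr fun n ↦ ?_)
  rw [Function.comp_apply, hL.charFun_nsmul (r := unitFraction hT n) (k n) rfl,
    hL.charFun_unitFraction hT hψ hψ0 h, ← Complex.exp_nat_mul]
  congr 1
  simp only [q]
  push_cast
  ring

end IsLevyProcess

theorem theorem4p9 {Ω : Type*} [m : MeasurableSpace Ω] (P : Measure Ω) [IsProbabilityMeasure P]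
    (T : ℝ≥0∞) (hT : 1 ≤ T) (ℱ : Filtration (TimeInterval T) m)
    (L : TimeInterval T → Ω → ℝ) (hL : IsLevyProcess L ℱ P) :
    IsInfinitelyDivisible (P.map (L ⟨1, hT⟩)) ∧
    (∃ τ : LevyTriplet, τ.IsTripletOf (P.map (L ⟨1, hT⟩))) ∧
    ∀ τ : LevyTriplet, τ.IsTripletOf (P.map (L ⟨1, hT⟩)) →
      ∀ (t : TimeInterval T) (u : ℝ),
        ∫ ω, Complex.exp (Complex.I * u * L t ω) ∂P =
          Complex.exp (((t.1 : ℝ) : ℂ) * τ.exponent u) := by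
  have hprob := hL.isProbabilityMeasure_map
  refine ⟨fun n hn ↦ ?_, ?_, fun τ hτ t u ↦ ?_⟩
  · obtain ⟨n, rfl⟩ := Nat.exists_eq_add_of_le' hn
    refine ⟨P.map (L (IsLevyProcess.unitFraction hT n)), hprob _, ?_⟩
    obtain ⟨_, hc⟩ := charFun_convPow (P.map (L (IsLevyProcess.unitFraction hT n))) (n + 1)
    refine Measure.ext_of_charFun (funext fun u ↦ ?_)
    rw [hc, hL.charFun_unitFraction_pow]
  · obtain ⟨ψ, hψ, hψ0, h⟩ := exists_continuous_log (hL.continuous_charFun_map ⟨1, hT⟩)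
      (hL.charFun_one_ne_zero hT) (by simp)
    obtain ⟨τ, hτ⟩ := exists_levyTriplet_exponent_eq_of_charFun
      (μ := fun n ↦ P.map (L (IsLevyProcess.unitFraction hT n))) hψ hψ0
      (hL.charFun_unitFraction hT hψ hψ0 fun u ↦ (h u).symm)
    exact ⟨τ, fun u ↦ by rw [integral_exp_eq_charFun, hτ, h]⟩
  -- No uniqueness of the triplet is needed: the exponent of `τ` is itself a continuous logarithm of
  -- φ_1 vanishing at 0.
  · rw [← hL.charFun_eq_exp hT τ.continuous_exponent τ.exponent_zero
      (fun u ↦ by rw [← integral_exp_eq_charFun, hτ]) t u, ← integral_exp_eq_charFun,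
      integral_map (hL.measurable t).aemeasurable (by fun_prop)]
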